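/- Let $(W,S)$ be a Coxeter system with $S$ finite. For $I\subseteq S$ let $W_I=\langle I\rangle$ be the corresponding standard parabolic subgroup of $W$. A subgroup of $W$ is called maximal finite if it is finite and every subgroup of $W$ properly containing it is infinite. Let $$M_W:=\{I\subseteq S \mid W_I \text{ is finite, and } W_J \text{ is infinite for every } J \text{ with } I\subsetneq J\subseteq S\}.$$ Then the family $(W_I)_{I\in M_W}$ is a system of representatives of the conjugacy classes of maximal finite subgroups of $W$: for every $I\in M_W$ the subgroup $W_I$ is maximal finite, and for every maximal finite subgroup $H$ of $W$ there is exactly one $I\in M_W$ such that $H$ is conjugate in $W$ to $W_I$. -/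

import Mathlib

/-- A subgroup `H` of a group `G` is *maximal finite* if it is finite and every subgroup that
properly contains it is infinite. -/
def IsMaximalFinite {G : Type*} [Group G] (H : Subgroup G) : Prop :=
  Finite H ∧ ∀ H' : Subgroup G, H < H' → Infinite H'

/-- Two subgroups `H`, `K` of `G` are conjugate: `K = g H g⁻¹` for some `g` in `G`. -/
def AreConjSubgroups {G : Type*} [Group G] (H K : Subgroup G) : Prop :=
  ∃ g : G, K = H.map (MulAut.conj g).toMonoidHom

namespace CoxeterSystem

variable {B W : Type*} [Group W] {M : CoxeterMatrix B}

/-- The set `S ⊆ W` of simple reflections of a Coxeter system. -/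
def simpleSet (cs : CoxeterSystem M W) : Set W := Set.range cs.simple

/-- The set `M_W` of all subsets `I` of `S` that are maximal among the subsets whose standard
parabolic subgroup `W_I = ⟨I⟩` is finite. -/
def maximalSpherical (cs : CoxeterSystem M W) : Set (Set W) :=
  {I | I ⊆ cs.simpleSet ∧ Finite (Subgroup.closure I) ∧
    ∀ J : Set W, J ⊆ cs.simpleSet → I ⊂ J → Infinite (Subgroup.closure J)}

end CoxeterSystem

/-! Let `W` act on functionals on its geometric representation. A functional positive on all but
finitely many positive roots ("interior") has a dominant translate (`exists_isDominant_translate`),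
and a dominant functional is alone in its orbit among dominant ones, with stabilizer generated by
the simple reflections fixing it (`IsDominant.translate_eq_self`). A finite `H` fixes an interior
functional, obtained by summing over `H`, so it lies in a conjugate of a standard parabolic, which
is finite by `IsInterior.finite_closure`; maximality of `H` gives equality. Conversely, let `I` be
maximal spherical. An interior functional fixed by a finite overgroup of `W_I` must be positive on
the simple roots outside `I`, since otherwise a larger parabolic would be finite. Its stabilizer is
then `W_I`, so the overgroup is no larger. Uniqueness holds because `I` is read off from the unique
dominant functional in the orbit. -/

open Real

/-! ### The geometric representation -/

/-- The sequence `sin (n θ) / sin θ` for `c = 2 cos θ`, defined by its recurrence. -/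
def sineRatio (c : ℝ) : ℕ → ℝ
  | 0 => 0
  | 1 => 1
  | n + 2 => c * sineRatio c (n + 1) - sineRatio c n

theorem sineRatio_mul_sin (θ : ℝ) (n : ℕ) :
    sineRatio (2 * cos θ) n * sin θ = sin (n * θ) := by
  induction n using Nat.twoStepInduction with
  | zero => simp [sineRatio]
  | one => simp [sineRatio]
  | more n h0 h1 =>
    have e1 : ((n + 1 : ℕ) : ℝ) * θ = n * θ + θ := by push_cast; ring
    have e2 : ((n + 2 : ℕ) : ℝ) * θ = n * θ + θ + θ := by push_cast; ring
    rw [sineRatio, sub_mul, mul_assoc, h0, h1, e1, e2]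
    simp only [sin_add, cos_add]
    linear_combination sin (n * θ) * sin_sq_add_cos_sq θ

/-- The case `m = ∞`: division by zero gives `θ = π / 0 = 0`, where the quotient of sines is useless
but the recurrence still makes sense. -/
theorem sineRatio_two (n : ℕ) : sineRatio 2 n = n := by
  induction n using Nat.twoStepInduction with
  | zero => simp [sineRatio]
  | one => simp [sineRatio]
  | more n h0 h1 => rw [sineRatio, h0, h1]; push_cast; ring

namespace CoxeterMatrix

variable {B : Type*} (M : CoxeterMatrix B)

/-- The Cartan matrix of the geometric representation (twice the Gram matrix of the simple
roots). An entry `0` of the Coxeter matrix, which stands for `∞`, gives `-2`. -/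
noncomputable def cartan (s t : B) : ℝ := -(2 * cos (π / M s t))

theorem cartan_self (s : B) : M.cartan s s = 2 := by simp [cartan]

theorem cartan_comm (s t : B) : M.cartan s t = M.cartan t s := by
  rw [cartan, cartan, M.symmetric]

theorem two_le_of_ne {s t : B} (h : s ≠ t) (h0 : M s t ≠ 0) : 2 ≤ M s t := by
  have := M.off_diagonal s t h
  lia

theorem sin_pi_div_pos {s t : B} (h : s ≠ t) (h0 : M s t ≠ 0) : 0 < sin (π / M s t) := by
  have h2 : (2 : ℝ) ≤ M s t := by exact_mod_cast M.two_le_of_ne h h0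
  apply sin_pos_of_pos_of_lt_pi (by positivity)
  rw [div_lt_iff₀ (by linarith)]
  nlinarith [pi_pos]

/-- The coefficients of the roots of the dihedral group generated by `s` and `t`. -/
noncomputable def dihedralCoeff (s t : B) (n : ℕ) : ℝ := sineRatio (-M.cartan s t) n

theorem dihedralCoeff_add_two (s t : B) (n : ℕ) :
    M.dihedralCoeff s t (n + 2) =
      -M.cartan s t * M.dihedralCoeff s t (n + 1) - M.dihedralCoeff s t n := rfl

theorem dihedralCoeff_nonneg {s t : B} (h : s ≠ t) {n : ℕ} (hn : M s t = 0 ∨ n ≤ M s t) :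
    0 ≤ M.dihedralCoeff s t n := by
  unfold dihedralCoeff
  by_cases h0 : M s t = 0
  · simp [cartan, h0, sineRatio_two]
  have hn := hn.resolve_left h0
  have hs := M.sin_pi_div_pos h h0
  have hm : (0 : ℝ) < M s t := by positivity
  have hn' : (n : ℝ) ≤ M s t := by exact_mod_cast hn
  rw [cartan, neg_neg, ← mul_nonneg_iff_of_pos_right hs, sineRatio_mul_sin]
  apply sin_nonneg_of_nonneg_of_le_pi (by positivity)
  rw [mul_div_assoc', div_le_iff₀ hm]
  nlinarith [pi_pos]

theorem dihedralCoeff_two_mul {s t : B} (h : s ≠ t) (h0 : M s t ≠ 0) :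
    M.dihedralCoeff s t (2 * M s t) = 0 := by
  have hs := M.sin_pi_div_pos h h0
  have hm : (M s t : ℝ) ≠ 0 := by exact_mod_cast h0
  apply mul_right_cancel₀ hs.ne'
  rw [dihedralCoeff, cartan, neg_neg, sineRatio_mul_sin,
    show ((2 * M s t : ℕ) : ℝ) * (π / M s t) = 2 * π by push_cast; field_simp]
  simp

theorem dihedralCoeff_two_mul_add_one {s t : B} (h : s ≠ t) (h0 : M s t ≠ 0) :
    M.dihedralCoeff s t (2 * M s t + 1) = 1 := by
  have hs := M.sin_pi_div_pos h h0
  have hm : (M s t : ℝ) ≠ 0 := by exact_mod_cast h0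
  apply mul_right_cancel₀ hs.ne'
  rw [dihedralCoeff, cartan, neg_neg, sineRatio_mul_sin,
    show ((2 * M s t + 1 : ℕ) : ℝ) * (π / M s t) = π / M s t + 2 * π by push_cast; field_simp; ring,
    sin_add_two_pi, one_mul]

variable [Fintype B]

/-- The coroot `v ↦ 2 ⟨α_s, v⟩`. -/
noncomputable def coroot (s : B) : Module.Dual ℝ (B → ℝ) := ∑ t, M.cartan s t • LinearMap.proj t

theorem coroot_apply (s : B) (v : B → ℝ) : M.coroot s v = ∑ t, M.cartan s t * v t := by
  simp [coroot]

variable [DecidableEq B]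

@[simp]
theorem coroot_single (s t : B) (x : ℝ) : M.coroot s (Pi.single t x) = M.cartan s t * x := by
  simp [coroot_apply, Pi.single_apply]

/-- The simple reflection `v ↦ v - 2 ⟨α_s, v⟩ α_s`. -/
noncomputable def simpleReflection (s : B) : Module.End ℝ (B → ℝ) :=
  Module.preReflection (Pi.single s 1) (M.coroot s)

theorem simpleReflection_apply (s : B) (v : B → ℝ) :
    M.simpleReflection s v = v - M.coroot s v • Pi.single s 1 := rfl

theorem simpleReflection_mul_self (s : B) : M.simpleReflection s * M.simpleReflection s = 1 := by
  refine LinearMap.ext fun v ↦ ?_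
  exact Module.involutive_preReflection (by simp [cartan_self]) v

theorem simpleReflection_combination (s t : B) (x y : ℝ) :
    M.simpleReflection t (Pi.single s x + Pi.single t y) =
      Pi.single s x + Pi.single t (-M.cartan s t * x - y) := by
  rw [simpleReflection_apply]
  ext i
  simp [cartan_self, M.cartan_comm t s, Pi.single_apply]
  split_ifs <;> ring

theorem simpleReflection_mul_pow_apply_single (s t : B) (n : ℕ) :
    ((M.simpleReflection s * M.simpleReflection t) ^ n) (Pi.single s 1) =
      Pi.single s (M.dihedralCoeff s t (2 * n + 1)) + Pi.single t (M.dihedralCoeff s t (2 * n)) := by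
  induction n with
  | zero => simp [dihedralCoeff, sineRatio]
  | succ n ih =>
    rw [pow_succ', Module.End.mul_apply, ih, Module.End.mul_apply, simpleReflection_combination,
      ← dihedralCoeff_add_two, add_comm (Pi.single s _), simpleReflection_combination,
      cartan_comm, ← dihedralCoeff_add_two, add_comm]
    rfl

theorem simpleReflection_mul_pow_apply_single_left {s t : B} (h : s ≠ t) (h0 : M s t ≠ 0) :
    ((M.simpleReflection s * M.simpleReflection t) ^ M s t) (Pi.single s 1) = Pi.single s 1 := by
  simp [simpleReflection_mul_pow_apply_single, M.dihedralCoeff_two_mul h h0,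
    M.dihedralCoeff_two_mul_add_one h h0]

theorem simpleReflection_mul_pow_apply_single_right {s t : B} (h : s ≠ t) (h0 : M s t ≠ 0) :
    ((M.simpleReflection s * M.simpleReflection t) ^ M s t) (Pi.single t 1) = Pi.single t 1 := by
  have h1 := M.simpleReflection_mul_pow_apply_single_left h.symm (M.symmetric s t ▸ h0)
  rw [M.symmetric t s] at h1
  have h2 : ∀ n : ℕ, (M.simpleReflection s * M.simpleReflection t) ^ n *
      (M.simpleReflection t * M.simpleReflection s) ^ n = 1 := by
    intro n
    induction n with
    | zero => simp
    | succ n ih =>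
      rw [pow_succ, pow_succ']
      calc _ = (M.simpleReflection s * M.simpleReflection t) ^ n * (M.simpleReflection s *
            (M.simpleReflection t * M.simpleReflection t) * M.simpleReflection s) *
            (M.simpleReflection t * M.simpleReflection s) ^ n := by noncomm_ring
        _ = 1 := by rw [simpleReflection_mul_self, mul_one, simpleReflection_mul_self, mul_one, ih]
  have h3 := LinearMap.congr_fun (h2 (M s t)) (Pi.single t 1)
  rwa [Module.End.mul_apply, h1] at h3

theorem isLiftable_simpleReflection : M.IsLiftable M.simpleReflection := by
  intro s t
  by_cases h0 : M s t = 0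
  · rw [h0, pow_zero]
  by_cases h : s = t
  · subst h
    rw [simpleReflection_mul_self, one_pow]
  have hs := M.sin_pi_div_pos h h0
  refine LinearMap.ext fun v ↦ ?_
  set a := M.cartan s t with ha
  have hd : 4 - a ^ 2 ≠ 0 := by
    have := sin_sq_add_cos_sq (π / M s t)
    rw [ha, cartan]
    nlinarith
  -- Cramer's rule; the determinant is `4 sin² (π / m) ≠ 0`. It splits `v` into a vector of the
  -- plane of `s`, `t` and a vector `u` killed by both coroots.
  obtain ⟨x, y, hx, hy⟩ : ∃ x y : ℝ, 2 * x + a * y = M.coroot s v ∧ a * x + 2 * y = M.coroot t v :=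
    ⟨(2 * M.coroot s v - a * M.coroot t v) / (4 - a ^ 2),
      (2 * M.coroot t v - a * M.coroot s v) / (4 - a ^ 2), by field_simp; ring, by field_simp; ring⟩
  set u := v - (x • Pi.single s 1 + y • Pi.single t 1) with hu
  have hus : M.simpleReflection s u = u := by
    rw [simpleReflection_apply, sub_eq_self, hu]
    simp [cartan_self, ← hx, ← ha, -Pi.single_eq_zero_iff, mul_comm]
  have hut : M.simpleReflection t u = u := by
    rw [simpleReflection_apply, sub_eq_self, hu]
    simp [cartan_self, ← hy, M.cartan_comm t s, ← ha, -Pi.single_eq_zero_iff, mul_comm]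
  have huu : ∀ n : ℕ, ((M.simpleReflection s * M.simpleReflection t) ^ n) u = u := by
    intro n
    induction n with
    | zero => rfl
    | succ n ih => rw [pow_succ', Module.End.mul_apply, ih, Module.End.mul_apply, hut, hus]
  have hv : v = u + (x • Pi.single s 1 + y • Pi.single t 1) := by rw [hu]; abel
  rw [hv, map_add, map_add, map_smul, map_smul, huu,
    M.simpleReflection_mul_pow_apply_single_left h h0,
    M.simpleReflection_mul_pow_apply_single_right h h0]
  rfl

end CoxeterMatrix

/-! ### Descents and signs of roots -/

namespace CoxeterSystem

variable {B W : Type*} [Group W] {M : CoxeterMatrix B} (cs : CoxeterSystem M W)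
  [Fintype B] [DecidableEq B]

/-- The geometric representation of a Coxeter group. -/
noncomputable def geomRep : W →* Module.End ℝ (B → ℝ) :=
  cs.lift ⟨M.simpleReflection, M.isLiftable_simpleReflection⟩

@[simp]
theorem geomRep_simple (s : B) : cs.geomRep (cs.simple s) = M.simpleReflection s :=
  cs.lift_apply_simple _ _

theorem geomRep_mul_apply (w w' : W) (v : B → ℝ) :
    cs.geomRep (w * w') v = cs.geomRep w (cs.geomRep w' v) := by
  rw [map_mul, Module.End.mul_apply]

@[simp]
theorem geomRep_inv_apply_self (w : W) (v : B → ℝ) :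
    cs.geomRep w⁻¹ (cs.geomRep w v) = v := by
  rw [← geomRep_mul_apply, inv_mul_cancel, map_one, Module.End.one_apply]

@[simp]
theorem geomRep_apply_inv_self (w : W) (v : B → ℝ) :
    cs.geomRep w (cs.geomRep w⁻¹ v) = v := by
  rw [← geomRep_mul_apply, mul_inv_cancel, map_one, Module.End.one_apply]

theorem geomRep_alternatingWord_apply_single (s t : B) (n : ℕ) :
    cs.geomRep (cs.wordProd (alternatingWord s t n)) (Pi.single s 1) =
      if Even n then
        Pi.single s (M.dihedralCoeff s t (n + 1)) + Pi.single t (M.dihedralCoeff s t n)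
      else Pi.single s (M.dihedralCoeff s t n) + Pi.single t (M.dihedralCoeff s t (n + 1)) := by
  induction n with
  | zero => simp [alternatingWord, CoxeterMatrix.dihedralCoeff, sineRatio]
  | succ n ih =>
    rw [alternatingWord_succ', wordProd_cons, geomRep_mul_apply, ih]
    by_cases hn : Even n
    · have : ¬ Even (n + 1) := by simp [hn, parity_simps]
      rw [if_pos hn, if_pos hn, if_neg this, geomRep_simple, M.simpleReflection_combination,
        ← M.dihedralCoeff_add_two]
    · have : Even (n + 1) := by simp [hn, parity_simps]
      rw [if_neg hn, if_neg hn, if_pos this, geomRep_simple, add_comm,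
        M.simpleReflection_combination, M.cartan_comm t s, ← M.dihedralCoeff_add_two, add_comm]

/-- If `w` is shorter than `w * s`, then `w` sends the simple root of `s` to a positive root. -/
theorem geomRep_single_nonneg {w : W} {s : B} (h : ¬ cs.IsRightDescent w s) :
    0 ≤ cs.geomRep w (Pi.single s 1) := by
  induction hl : cs.length w using Nat.strong_induction_on generalizing w s with
  | _ l ih =>
  by_cases hw : w = 1
  · simp [hw]
  obtain ⟨t, ht⟩ := cs.exists_rightDescent_of_ne_one hw
  have hst : s ≠ t := by rintro rfl; exact h ht
  -- Split off on the right of `w` the longest alternating word ending in `t` with additive lengths.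
  -- The cofactor `v` then has neither `s` nor `t` as a descent, so induction applies to it.
  let P : ℕ → Prop := fun k ↦
    ∃ v, v * cs.wordProd (alternatingWord s t k) = w ∧ cs.length v + k = cs.length w
  have hP1 : P 1 := ⟨w * cs.simple t, by simp [alternatingWord], cs.isRightDescent_iff.1 ht⟩
  classical
  have hbound : ∀ k, P k → k ≤ l := by rintro k ⟨v, -, hv⟩; lia
  set k := Nat.findGreatest P l with hk
  have hPk : P k := Nat.findGreatest_spec (hbound 1 hP1) hP1
  have hk1 : 1 ≤ k := Nat.le_findGreatest (hbound 1 hP1) hP1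
  have hPk' : ¬ P (k + 1) := fun h' ↦ by
    have := Nat.le_findGreatest (hbound _ h') h'
    lia
  obtain ⟨v, hv, hlv⟩ := hPk
  -- A word longer than `m` is not reduced; one of length `m` could be rewritten by the braid
  -- relation to end in `s`, making `s` a descent of `w`.
  have hkm : M s t = 0 ∨ k + 1 ≤ M s t := by
    by_contra! hcon
    rcases Nat.lt_succ_iff.1 hcon.2 |>.lt_or_eq with hlt | heq
    · apply cs.not_isReduced_alternatingWord s t hcon.1 hlt
      have h1 := cs.length_mul_le v (cs.wordProd (alternatingWord s t k))
      have h2 := cs.length_wordProd_le (alternatingWord s t k)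
      rw [length_alternatingWord] at h2
      rw [IsReduced, length_alternatingWord]
      rw [hv] at h1
      lia
    · apply h
      have h1 : w * cs.simple s = v * cs.wordProd (alternatingWord s t (k - 1)) := by
        have h2 := cs.wordProd_braidWord_eq s t
        rw [braidWord, braidWord, M.symmetric t s, heq, ← Nat.sub_add_cancel hk1,
          alternatingWord_succ t s, wordProd_concat, Nat.sub_add_cancel hk1] at h2
        rw [← hv, h2]
        simp [mul_assoc]
      have h3 := cs.length_mul_le v (cs.wordProd (alternatingWord s t (k - 1)))
      have h4 := cs.length_wordProd_le (alternatingWord s t (k - 1))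
      rw [length_alternatingWord] at h4
      rw [IsRightDescent, h1]
      lia
  -- A descent `r` of `v` either prolongs the alternating word, against maximality, or cancels its
  -- first letter, making `w` too short.
  have hvdesc : ∀ r, r = s ∨ r = t → ¬ cs.IsRightDescent v r := by
    intro r hr hd
    have hd' := cs.isRightDescent_iff.1 hd
    by_cases hrk : r = if Even k then t else s
    · apply hPk'
      refine ⟨v * cs.simple r, ?_, by lia⟩
      rw [alternatingWord_succ', ← hrk, wordProd_cons, ← mul_assoc,
        simple_mul_simple_cancel_right, hv]
    · have hr' : r = if Even (k - 1) then t else s := by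
        have : Even (k - 1) ↔ ¬ Even k := by
          grind
        grind
      have hw' : w = v * cs.simple r * cs.wordProd (alternatingWord s t (k - 1)) := by
        rw [mul_assoc, ← wordProd_cons, hr', ← alternatingWord_succ', Nat.sub_add_cancel hk1, hv]
      have h1 := cs.length_mul_le (v * cs.simple r) (cs.wordProd (alternatingWord s t (k - 1)))
      have h2 := cs.length_wordProd_le (alternatingWord s t (k - 1))
      rw [length_alternatingWord] at h2
      rw [← hw'] at h1
      lia
  have hvs := ih (cs.length v) (by lia) (hvdesc s (.inl rfl)) rfl
  have hvt := ih (cs.length v) (by lia) (hvdesc t (.inr rfl)) rfl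
  have hcomb : ∀ x y : ℝ, 0 ≤ x → 0 ≤ y →
      0 ≤ cs.geomRep v (Pi.single s x + Pi.single t y) := by
    intro x y hx hy
    have : (Pi.single s x + Pi.single t y : B → ℝ) = x • Pi.single s 1 + y • Pi.single t 1 := by
      simp [← Pi.single_smul']
    rw [this, map_add, map_smul, map_smul]
    exact add_nonneg (smul_nonneg hx hvs) (smul_nonneg hy hvt)
  have hc1 := M.dihedralCoeff_nonneg hst hkm
  have hc0 := M.dihedralCoeff_nonneg hst (n := k) (by lia)
  rw [← hv, geomRep_mul_apply, geomRep_alternatingWord_apply_single]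
  split_ifs
  · exact hcomb _ _ hc1 hc0
  · exact hcomb _ _ hc0 hc1

theorem geomRep_single_nonpos {w : W} {s : B} (h : cs.IsRightDescent w s) :
    cs.geomRep w (Pi.single s 1) ≤ 0 := by
  have h1 := cs.geomRep_single_nonneg (cs.isRightDescent_iff_not_isRightDescent_mul.1 h)
  rw [geomRep_mul_apply, geomRep_simple, M.simpleReflection_apply] at h1
  have h2 : (Pi.single s 1 - M.coroot s (Pi.single s 1) • Pi.single s 1 : B → ℝ) =
      -Pi.single s 1 := by
    rw [M.coroot_single, M.cartan_self, mul_one, two_smul]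
    abel
  rw [h2, map_neg] at h1
  exact neg_nonneg.1 h1

end CoxeterSystem

/-! ### Roots and inversion sets -/

namespace CoxeterMatrix

variable {B : Type*} (M : CoxeterMatrix B) [Fintype B] [DecidableEq B]

theorem simpleReflection_apply_of_ne {s t : B} (h : t ≠ s) (v : B → ℝ) :
    M.simpleReflection s v t = v t := by
  simp [simpleReflection_apply, h]

theorem simpleReflection_single (s : B) :
    M.simpleReflection s (Pi.single s 1) = -Pi.single s 1 := by
  rw [simpleReflection_apply, coroot_single, cartan_self, mul_one, two_smul]
  abel

theorem simpleReflection_apply_self (s : B) (v : B → ℝ) :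
    M.simpleReflection s (M.simpleReflection s v) = v := by
  rw [← Module.End.mul_apply, simpleReflection_mul_self, Module.End.one_apply]

/-- The quadratic form of the geometric representation is invariant under simple reflections. -/
theorem sum_mul_coroot_simpleReflection (s : B) (v : B → ℝ) :
    ∑ t, M.simpleReflection s v t * M.coroot t (M.simpleReflection s v) =
      ∑ t, v t * M.coroot t v := by
  have h1 : ∑ t, v t * M.cartan t s = M.coroot s v := by
    rw [coroot_apply]
    exact Finset.sum_congr rfl fun t _ ↦ by rw [M.cartan_comm, mul_comm]
  have h2 : ∀ t, M.simpleReflection s v t * M.coroot t (M.simpleReflection s v) =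
      v t * M.coroot t v - M.coroot s v * (v t * M.cartan t s) -
        (if t = s then M.coroot s v * (M.coroot s v - M.coroot s v * M.cartan s s) else 0) := by
    intro t
    rw [simpleReflection_apply, map_sub, map_smul, coroot_single]
    simp only [Pi.sub_apply, Pi.smul_apply, Pi.single_apply, smul_eq_mul]
    split_ifs with h
    · subst h; ring
    · ring
  simp only [h2, Finset.sum_sub_distrib, ← Finset.mul_sum, h1, Finset.sum_ite_eq',
    Finset.mem_univ, if_true, cartan_self]
  ring

end CoxeterMatrix

namespace CoxeterSystem

variable {B W : Type*} [Group W] {M : CoxeterMatrix B} (cs : CoxeterSystem M W)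
  [Fintype B] [DecidableEq B]

/-- The root system of a Coxeter group in its geometric representation. -/
def roots : Set (B → ℝ) := {v | ∃ w s, v = cs.geomRep w (Pi.single s 1)}

/-- The positive roots of a Coxeter group. -/
def posRoots : Set (B → ℝ) := {v ∈ cs.roots | 0 ≤ v}

/-- The positive roots that become negative under `w`. -/
def rootInversions (w : W) : Set (B → ℝ) := {v ∈ cs.posRoots | cs.geomRep w v ≤ 0}

variable {cs}

theorem single_mem_roots (s : B) : Pi.single s 1 ∈ cs.roots := ⟨1, s, by simp⟩

theorem single_mem_posRoots (s : B) : Pi.single s 1 ∈ cs.posRoots :=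
  ⟨single_mem_roots s, Pi.single_nonneg.2 zero_le_one⟩

theorem geomRep_mem_roots {v : B → ℝ} (hv : v ∈ cs.roots) (w : W) : cs.geomRep w v ∈ cs.roots := by
  obtain ⟨w', s, rfl⟩ := hv
  exact ⟨w * w', s, (cs.geomRep_mul_apply _ _ _).symm⟩

theorem neg_mem_roots {v : B → ℝ} (hv : v ∈ cs.roots) : -v ∈ cs.roots := by
  obtain ⟨w, s, rfl⟩ := hv
  refine ⟨w * cs.simple s, s, ?_⟩
  rw [geomRep_mul_apply, geomRep_simple, M.simpleReflection_single, map_neg]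

theorem nonneg_or_nonpos_of_mem_roots {v : B → ℝ} (hv : v ∈ cs.roots) : 0 ≤ v ∨ v ≤ 0 := by
  obtain ⟨w, s, rfl⟩ := hv
  by_cases h : cs.IsRightDescent w s
  · exact .inr (cs.geomRep_single_nonpos h)
  · exact .inl (cs.geomRep_single_nonneg h)

theorem sum_mul_coroot_of_mem_roots {v : B → ℝ} (hv : v ∈ cs.roots) :
    ∑ t, v t * M.coroot t v = 2 := by
  obtain ⟨w, s, rfl⟩ := hv
  induction w using cs.simple_induction_left with
  | one => simp [Pi.single_apply, M.cartan_self]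
  | mul_simple_left w i ih =>
    rw [geomRep_mul_apply, geomRep_simple, M.sum_mul_coroot_simpleReflection, ih]

theorem ne_zero_of_mem_roots {v : B → ℝ} (hv : v ∈ cs.roots) : v ≠ 0 := by
  rintro rfl
  simpa using sum_mul_coroot_of_mem_roots hv

/-- The reflection changes only the `s`-coordinate, so `v` is supported on `s`; the normalization of
roots fixes the coefficient. -/
theorem eq_single_of_simpleReflection_nonpos {v : B → ℝ} (hv : v ∈ cs.posRoots) {s : B}
    (h : M.simpleReflection s v ≤ 0) : v = Pi.single s 1 := by
  have h1 : v = Pi.single s (v s) := by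
    ext t
    by_cases hts : t = s
    · subst hts; simp
    · have := h t
      rw [M.simpleReflection_apply_of_ne hts] at this
      rw [Pi.single_eq_of_ne hts]
      exact le_antisymm this (hv.2 t)
  have h2 := sum_mul_coroot_of_mem_roots hv.1
  have h3 : 0 ≤ v s := hv.2 s
  rw [h1] at h2
  simp [Pi.single_apply, M.cartan_self] at h2
  have h4 : v s = 1 := by nlinarith
  rw [h1, h4]

theorem simpleReflection_mem_posRoots {v : B → ℝ} (hv : v ∈ cs.posRoots) {s : B}
    (h : v ≠ Pi.single s 1) : M.simpleReflection s v ∈ cs.posRoots := by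
  have h1 : M.simpleReflection s v ∈ cs.roots := by
    rw [← cs.geomRep_simple]
    exact geomRep_mem_roots hv.1 _
  exact ⟨h1, (nonneg_or_nonpos_of_mem_roots h1).resolve_right
    fun h' ↦ h (eq_single_of_simpleReflection_nonpos hv h')⟩

theorem finite_rootInversions (w : W) : (cs.rootInversions w).Finite := by
  induction w using cs.simple_induction_left with
  | one =>
    refine Set.finite_empty.subset fun v hv ↦ ?_
    have := hv.2
    rw [map_one, Module.End.one_apply] at this
    exact ne_zero_of_mem_roots hv.1.1 (le_antisymm this hv.1.2)
  | mul_simple_left w s ih =>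
    refine (ih.union (Set.finite_singleton (cs.geomRep w⁻¹ (Pi.single s 1)))).subset ?_
    rintro v ⟨hv, hv'⟩
    rw [geomRep_mul_apply, geomRep_simple] at hv'
    have hr := geomRep_mem_roots hv.1 w
    rcases nonneg_or_nonpos_of_mem_roots hr with h | h
    · right
      rw [Set.mem_singleton_iff, ← eq_single_of_simpleReflection_nonpos ⟨hr, h⟩ hv',
        geomRep_inv_apply_self]
    · exact .inl ⟨hv, h⟩

/-- For a right descent `s` of `u * w⁻¹`, the root `w⁻¹ α_s` becomes positive under `w` and negative
under `u`; it or its negative separates the inversion sets. -/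
theorem rootInversions_injective : Function.Injective cs.rootInversions := by
  intro u w h
  by_contra hne
  obtain ⟨s, hs⟩ := cs.exists_rightDescent_of_ne_one (w := u * w⁻¹) (by rwa [Ne, mul_inv_eq_one])
  have hneg := cs.geomRep_single_nonpos hs
  rw [geomRep_mul_apply] at hneg
  have hroot := geomRep_mem_roots (cs := cs) (single_mem_roots s) w⁻¹
  have hpos : (0 : B → ℝ) ≤ Pi.single s 1 := Pi.single_nonneg.2 zero_le_one
  have hne0 := ne_zero_of_mem_roots (cs := cs) (single_mem_roots s)
  rcases nonneg_or_nonpos_of_mem_roots hroot with h' | h'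
  · have h1 : cs.geomRep w⁻¹ (Pi.single s 1) ∈ cs.rootInversions w := h ▸ ⟨⟨hroot, h'⟩, hneg⟩
    have h2 := h1.2
    rw [geomRep_apply_inv_self] at h2
    exact hne0 (le_antisymm h2 hpos)
  · have h1 : -cs.geomRep w⁻¹ (Pi.single s 1) ∈ cs.rootInversions u := by
      rw [h]
      refine ⟨⟨neg_mem_roots hroot, neg_nonneg.2 h'⟩, ?_⟩
      rw [map_neg, geomRep_apply_inv_self]
      exact neg_nonpos.2 hpos
    have h2 := h1.2
    rw [map_neg, neg_nonpos] at h2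
    refine ne_zero_of_mem_roots (geomRep_mem_roots hroot u) (le_antisymm hneg h2)

theorem finite_of_rootInversions_subset {K : Set W} {F : Set (B → ℝ)} (hF : F.Finite)
    (h : ∀ w ∈ K, cs.rootInversions w ⊆ F) : K.Finite :=
  Set.Finite.of_finite_image (hF.finite_subsets.subset (by rintro _ ⟨w, hw, rfl⟩; exact h w hw))
    rootInversions_injective.injOn

theorem geomRep_apply_of_mem_closure {T : Set B} {w : W}
    (hw : w ∈ Subgroup.closure (cs.simple '' T)) {t : B} (ht : t ∉ T) (v : B → ℝ) :
    cs.geomRep w v t = v t := by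
  induction hw using Subgroup.closure_induction generalizing v with
  | mem w hw =>
    obtain ⟨s, hs, rfl⟩ := hw
    rw [geomRep_simple, M.simpleReflection_apply_of_ne]
    rintro rfl
    exact ht hs
  | one => simp
  | mul u w _ _ hu hw => rw [geomRep_mul_apply, hu, hw]
  | inv w _ hw => rw [← hw (cs.geomRep w⁻¹ v), geomRep_apply_inv_self]

/-! ### Dominant and interior functionals -/

variable (cs)

/-- The functional `x` acted on by `w`. -/
noncomputable def translate (x : Module.Dual ℝ (B → ℝ)) (w : W) : Module.Dual ℝ (B → ℝ) :=
  x ∘ₗ cs.geomRep w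

/-- The functional `x` is nonnegative on all simple roots, i.e. it lies in the closed fundamental
chamber. -/
def IsDominant (x : Module.Dual ℝ (B → ℝ)) : Prop := ∀ s, 0 ≤ x (Pi.single s 1)

/-- The functional `x` is positive on all but finitely many positive roots, i.e. it lies in the
interior of the Tits cone. -/
def IsInterior (x : Module.Dual ℝ (B → ℝ)) : Prop := {v ∈ cs.posRoots | x v ≤ 0}.Finite

variable {cs} {x : Module.Dual ℝ (B → ℝ)}

theorem translate_apply (w : W) (v : B → ℝ) : cs.translate x w v = x (cs.geomRep w v) := rfl

@[simp]
theorem translate_one : cs.translate x 1 = x := by ext; simp [translate_apply]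

theorem translate_translate (u w : W) :
    cs.translate (cs.translate x u) w = cs.translate x (u * w) := by
  refine LinearMap.ext fun v ↦ ?_
  rw [translate_apply, translate_apply, translate_apply, geomRep_mul_apply]

theorem apply_eq_sum (x : Module.Dual ℝ (B → ℝ)) (v : B → ℝ) :
    x v = ∑ s, v s * x (Pi.single s 1) := by
  conv_lhs => rw [← Finset.univ_sum_single v, map_sum]
  refine Finset.sum_congr rfl fun s _ ↦ ?_
  rw [← smul_eq_mul, ← map_smul, ← Pi.single_smul', smul_eq_mul, mul_one]

theorem IsDominant.apply_nonneg (hx : IsDominant x) {v : B → ℝ} (hv : 0 ≤ v) : 0 ≤ x v := by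
  rw [apply_eq_sum]
  exact Finset.sum_nonneg fun s _ ↦ mul_nonneg (hv s) (hx s)

theorem IsDominant.apply_nonpos (hx : IsDominant x) {v : B → ℝ} (hv : v ≤ 0) : x v ≤ 0 := by
  have := hx.apply_nonneg (neg_nonneg.2 hv)
  rwa [map_neg, neg_nonneg] at this

theorem translate_simple_eq_self_iff {s : B} :
    cs.translate x (cs.simple s) = x ↔ x (Pi.single s 1) = 0 := by
  constructor
  · intro h
    have := LinearMap.congr_fun h (Pi.single s 1)
    rw [translate_apply, geomRep_simple, M.simpleReflection_single, map_neg] at this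
    linarith
  · intro h
    refine LinearMap.ext fun v ↦ ?_
    rw [translate_apply, geomRep_simple, M.simpleReflection_apply, map_sub, map_smul, h, smul_zero,
      sub_zero]

theorem translate_eq_self_of_mem_closure {I : Set W} (hI : ∀ g ∈ I, cs.translate x g = x) {w : W}
    (hw : w ∈ Subgroup.closure I) : cs.translate x w = x := by
  induction hw using Subgroup.closure_induction with
  | mem w hw => exact hI w hw
  | one => exact translate_one
  | mul u w _ _ hu hw => rw [← translate_translate, hu, hw]
  | inv w _ hw => conv_lhs => rw [← hw, translate_translate, mul_inv_cancel, translate_one]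

/-- The closed fundamental chamber is a strict fundamental domain, and stabilizers of its points
are standard parabolic subgroups. -/
theorem IsDominant.translate_eq_self (hx : IsDominant x) {w : W}
    (hw : IsDominant (cs.translate x w)) :
    cs.translate x w = x ∧ w ∈ Subgroup.closure (cs.simple '' {s | x (Pi.single s 1) = 0}) := by
  induction hl : cs.length w using Nat.strong_induction_on generalizing w with
  | _ l ih =>
  by_cases h1 : w = 1
  · subst h1
    exact ⟨translate_one, one_mem _⟩
  obtain ⟨s, hs⟩ := cs.exists_rightDescent_of_ne_one h1
  -- `w` makes `α_s` negative, while both functionals are dominant. Hence `s` fixes the translate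
  -- and can be stripped off `w`.
  have h0 : cs.translate x w (Pi.single s 1) = 0 :=
    le_antisymm (hx.apply_nonpos (cs.geomRep_single_nonpos hs)) (hw s)
  have hws : cs.translate x (w * cs.simple s) = cs.translate x w := by
    rw [← translate_translate, translate_simple_eq_self_iff.2 h0]
  obtain ⟨h2, h3⟩ := ih _ (hl ▸ hs) (hws ▸ hw) rfl
  rw [hws] at h2
  rw [h2] at h0
  refine ⟨h2, ?_⟩
  have h4 := mul_mem h3 (Subgroup.subset_closure (Set.mem_image_of_mem cs.simple h0))
  rwa [simple_mul_simple_cancel_right] at h4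

/-- If `x` is negative on `α_s`, translating by `s` lowers the number of positive roots on which it
is negative, as `s` permutes the positive roots other than `α_s`. -/
theorem exists_isDominant_translate (hx : {v ∈ cs.posRoots | x v < 0}.Finite) :
    ∃ w, IsDominant (cs.translate x w) := by
  induction hn : {v ∈ cs.posRoots | x v < 0}.ncard using Nat.strong_induction_on
    generalizing x with
  | _ n ih =>
  by_cases hd : IsDominant x
  · exact ⟨1, by rwa [translate_one]⟩
  obtain ⟨s, hs⟩ : ∃ s, x (Pi.single s 1) < 0 := by simpa [IsDominant] using hd
  have hinj : Function.Injective (M.simpleReflection s) :=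
    Function.LeftInverse.injective (M.simpleReflection_apply_self s)
  have hsub : M.simpleReflection s '' {v ∈ cs.posRoots | cs.translate x (cs.simple s) v < 0} ⊂
      {v ∈ cs.posRoots | x v < 0} := by
    rw [Set.ssubset_iff_of_subset]
    · refine ⟨Pi.single s 1, ⟨single_mem_posRoots s, hs⟩, ?_⟩
      rintro ⟨v, ⟨hv, -⟩, hvs⟩
      have : v = -Pi.single s 1 := by
        rw [← M.simpleReflection_single, ← hvs, M.simpleReflection_apply_self]
      have := hv.2 s
      simp_all
      linarith
    · rintro _ ⟨v, ⟨hv, hxv⟩, rfl⟩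
      rw [translate_apply, geomRep_simple] at hxv
      refine ⟨simpleReflection_mem_posRoots hv ?_, hxv⟩
      rintro rfl
      rw [M.simpleReflection_single, map_neg] at hxv
      linarith
  have hcard := Set.ncard_lt_ncard hsub hx
  rw [Set.ncard_image_of_injective _ hinj, hn] at hcard
  obtain ⟨w, hw⟩ := ih _ hcard (Set.Finite.of_finite_image (hx.subset hsub.subset) hinj.injOn) rfl
  exact ⟨cs.simple s * w, by rwa [← translate_translate]⟩

theorem IsInterior.exists_isDominant_translate (hx : cs.IsInterior x) :
    ∃ w, IsDominant (cs.translate x w) :=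
  CoxeterSystem.exists_isDominant_translate (hx.subset fun _ hv ↦ ⟨hv.1, hv.2.le⟩)

theorem IsInterior.translate (hx : cs.IsInterior x) (w : W) : cs.IsInterior (cs.translate x w) := by
  refine ((finite_rootInversions (cs := cs) w).union (hx.image (cs.geomRep w⁻¹))).subset ?_
  rintro v ⟨hv, hxv⟩
  have hr := geomRep_mem_roots hv.1 w
  rcases nonneg_or_nonpos_of_mem_roots hr with h | h
  · exact .inr ⟨_, ⟨⟨hr, h⟩, hxv⟩, cs.geomRep_inv_apply_self _ _⟩
  · exact .inl ⟨hv, h⟩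

/-- Standard parabolic subgroups that belong to a face of the interior of the Tits cone, or on
which an interior functional is nonpositive, are finite. -/
theorem IsInterior.finite_closure (hx : cs.IsInterior x) {T : Set B}
    (hT : ∀ s ∈ T, x (Pi.single s 1) ≤ 0) : Finite (Subgroup.closure (cs.simple '' T)) := by
  -- Coordinates outside `T` are unchanged by `w`, so an inversion of `w` is supported on `T` and
  -- lies in the finite exceptional set of `x`.
  refine (finite_of_rootInversions_subset hx fun w hw v hv ↦ ⟨hv.1, ?_⟩ :
    (Subgroup.closure (cs.simple '' T) : Set W).Finite)
  rw [apply_eq_sum]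
  refine Finset.sum_nonpos fun s _ ↦ ?_
  have h1 : 0 ≤ v s := hv.1.2 s
  by_cases hs : s ∈ T
  · exact mul_nonpos_of_nonneg_of_nonpos h1 (hT s hs)
  · have h2 := hv.2 s
    rw [geomRep_apply_of_mem_closure hw hs] at h2
    rw [le_antisymm h2 h1, Pi.zero_apply, zero_mul]

/-- The coordinate sum is positive on every positive root, so its sum over `H` can be nonpositive
only on roots inverted by some element of `H`. -/
theorem exists_isInterior_translate_eq_self (H : Subgroup W) [Finite H] :
    ∃ x, cs.IsInterior x ∧ ∀ h ∈ H, cs.translate x h = x := by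
  have := Fintype.ofFinite H
  let f : Module.Dual ℝ (B → ℝ) := ∑ s, LinearMap.proj s
  have hf : ∀ v, f v = ∑ s, v s := fun v ↦ by simp [f]
  refine ⟨∑ h : H, cs.translate f h, ?_, fun g hg ↦ ?_⟩
  · refine (Set.finite_iUnion fun h : H ↦ finite_rootInversions (cs := cs) (h : W)).subset ?_
    rintro v ⟨hv, hle⟩
    by_contra hcon
    simp only [Set.mem_iUnion, not_exists] at hcon
    rw [LinearMap.sum_apply] at hle
    refine hle.not_gt (Finset.sum_pos (fun h _ ↦ ?_) ⟨1, Finset.mem_univ _⟩)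
    have hr := geomRep_mem_roots hv.1 (h : W)
    have hnn := (nonneg_or_nonpos_of_mem_roots hr).resolve_right fun h' ↦ hcon h ⟨hv, h'⟩
    obtain ⟨s, hs⟩ := Function.ne_iff.1 (ne_zero_of_mem_roots hr)
    rw [translate_apply, hf]
    exact Finset.sum_pos' (fun s _ ↦ hnn s) ⟨s, Finset.mem_univ _, (hnn s).lt_of_ne' hs⟩
  · refine LinearMap.ext fun v ↦ ?_
    rw [translate_apply, LinearMap.sum_apply, LinearMap.sum_apply]
    refine Fintype.sum_equiv (Equiv.mulRight (⟨g, hg⟩ : H)) _ _ fun h ↦ ?_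
    rw [translate_apply, translate_apply, ← geomRep_mul_apply]
    rfl

theorem simple_mem_closure_iff {I : Set W} (hI : ∀ s, cs.simple s ∈ I ↔ x (Pi.single s 1) = 0)
    (hS : I ⊆ cs.simpleSet) {s : B} : cs.simple s ∈ Subgroup.closure I ↔ cs.simple s ∈ I := by
  refine ⟨fun h ↦ ?_, fun h ↦ Subgroup.subset_closure h⟩
  rw [hI, ← translate_simple_eq_self_iff (cs := cs)]
  refine translate_eq_self_of_mem_closure (fun g hg ↦ ?_) h
  obtain ⟨t, rfl⟩ := hS hg
  rwa [translate_simple_eq_self_iff, ← hI]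

/-! ### Maximal spherical subsets and maximal finite subgroups -/

/-- An interior functional fixed by `W_I`, where `I` is maximal spherical, lies in the open face
of the fundamental chamber of type `I`. -/
theorem IsInterior.isDominant_of_maximalSpherical (hx : cs.IsInterior x) {I : Set W}
    (hI : I ∈ cs.maximalSpherical) (hfix : ∀ g ∈ Subgroup.closure I, cs.translate x g = x) :
    IsDominant x ∧ cs.simple '' {s | x (Pi.single s 1) = 0} = I := by
  obtain ⟨hS, -, hmax⟩ := hI
  have h0 : ∀ s, cs.simple s ∈ I → x (Pi.single s 1) = 0 := fun s hs ↦
    translate_simple_eq_self_iff.1 (hfix _ (Subgroup.subset_closure hs))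
  have hpos : ∀ s, cs.simple s ∉ I → 0 < x (Pi.single s 1) := by
    intro s hs
    by_contra! hle
    have hfin := hx.finite_closure (T := insert s (cs.simple ⁻¹' I)) (by
      rintro t (rfl | ht)
      exacts [hle, (h0 t ht).le])
    rw [Set.image_insert_eq, Set.image_preimage_eq_of_subset hS] at hfin
    exact (hmax (insert (cs.simple s) I) (Set.insert_subset ⟨s, rfl⟩ hS)
      (Set.ssubset_insert hs)).not_finite hfin
  refine ⟨fun s ↦ ?_, ?_⟩
  · by_cases hs : cs.simple s ∈ I
    · exact (h0 s hs).ge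
    · exact (hpos s hs).le
  · have : {s | x (Pi.single s 1) = 0} = cs.simple ⁻¹' I := by
      ext s
      exact ⟨fun h ↦ by_contra fun hs ↦ (hpos s hs).ne' h, h0 s⟩
    rw [this, Set.image_preimage_eq_of_subset hS]

theorem isMaximalFinite_of_maximalSpherical {I : Set W} (hI : I ∈ cs.maximalSpherical) :
    IsMaximalFinite (Subgroup.closure I) := by
  refine ⟨hI.2.1, fun H hH ↦ not_finite_iff_infinite.1 fun hfin ↦ ?_⟩
  obtain ⟨x, hx, hfix⟩ := exists_isInterior_translate_eq_self (cs := cs) H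
  obtain ⟨hdom, hzero⟩ := hx.isDominant_of_maximalSpherical hI fun g hg ↦ hfix g (hH.le hg)
  refine hH.not_ge fun h hh ↦ ?_
  have := (hdom.translate_eq_self (w := h) ((hfix h hh).symm ▸ hdom)).2
  rwa [hzero] at this

end CoxeterSystem

theorem IsMaximalFinite.eq_map_conj {G : Type*} [Group G] {H K : Subgroup G}
    (hH : IsMaximalFinite H) [Finite K] {g : G} (h : H ≤ K.map (MulAut.conj g).toMonoidHom) :
    H = K.map (MulAut.conj g).toMonoidHom :=
  have : Finite (K.map (MulAut.conj g).toMonoidHom) := Set.Finite.image _ (Set.toFinite (K : Set G))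
  by_contra fun hne ↦ (hH.2 _ (h.lt_of_ne hne)).not_finite this

namespace CoxeterSystem

variable {B W : Type*} [Group W] {M : CoxeterMatrix B} {cs : CoxeterSystem M W}
  [Fintype B] [DecidableEq B]

theorem existsUnique_maximalSpherical {H : Subgroup W} (hH : IsMaximalFinite H) :
    ∃! I : Set W, I ∈ cs.maximalSpherical ∧ AreConjSubgroups (Subgroup.closure I) H := by
  have := hH.1
  obtain ⟨x, hx, hfix⟩ := exists_isInterior_translate_eq_self (cs := cs) H
  obtain ⟨w, hdom⟩ := hx.exists_isDominant_translate
  set y := cs.translate x w with hy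
  set I := cs.simple '' {s | y (Pi.single s 1) = 0} with hI
  have hIS : I ⊆ cs.simpleSet := Set.image_subset_range _ _
  have hIfin : Finite (Subgroup.closure I) := (hx.translate w).finite_closure fun s hs ↦ hs.le
  have hIle : H ≤ (Subgroup.closure I).map (MulAut.conj w).toMonoidHom := by
    intro h hh
    refine ⟨w⁻¹ * h * w, ?_, by simp [mul_assoc]⟩
    refine (hdom.translate_eq_self (w := w⁻¹ * h * w) ?_).2
    rw [hy, translate_translate, show w * (w⁻¹ * h * w) = h * w by group, ← translate_translate,
      hfix h hh]
    exact hdom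
  have hIeq := hH.eq_map_conj hIle
  -- Passing through the fixed functional avoids needing injectivity of `cs.simple`.
  have hfixI : ∀ s, cs.simple s ∈ I ↔ y (Pi.single s 1) = 0 := by
    intro s
    refine ⟨?_, fun hs ↦ ⟨s, hs, rfl⟩⟩
    rintro ⟨t, ht, hts⟩
    rw [← translate_simple_eq_self_iff (cs := cs), ← hts]
    exact translate_simple_eq_self_iff.2 ht
  refine ⟨I, ⟨⟨hIS, hIfin, fun J hJS hIJ ↦ not_finite_iff_infinite.1 fun hJ ↦ ?_⟩, w, hIeq⟩, ?_⟩
  -- By maximality of `H`, `W_I` and `W_J` have the same conjugate `H`; so they agree, and `W_I`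
  -- contains no simple reflection outside `I`.
  · have hle := Subgroup.map_mono (f := (MulAut.conj w).toMonoidHom)
      (Subgroup.closure_mono hIJ.subset)
    have hJI : Subgroup.closure I = Subgroup.closure J :=
      Subgroup.map_injective (f := (MulAut.conj w).toMonoidHom) (MulAut.conj w).injective
        (hIeq.symm.trans (hH.eq_map_conj (hIle.trans hle)))
    refine hIJ.not_subset fun g hg ↦ ?_
    obtain ⟨s, rfl⟩ := hJS hg
    exact (simple_mem_closure_iff hfixI hIS).1 (hJI ▸ Subgroup.subset_closure hg)
  · rintro I' ⟨hI', a, ha⟩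
    have hfix' : ∀ g ∈ Subgroup.closure I',
        cs.translate (cs.translate x a) g = cs.translate x a := by
      intro g hg
      have hmem : a * g * a⁻¹ ∈ H := ha ▸ ⟨g, hg, rfl⟩
      rw [translate_translate, show a * g = a * g * a⁻¹ * a by group, ← translate_translate,
        hfix _ hmem]
    obtain ⟨hdom', hzero⟩ := (hx.translate a).isDominant_of_maximalSpherical hI' hfix'
    -- Two dominant functionals in one orbit coincide, and so do their zero sets `I` and `I'`.
    have hya : cs.translate (cs.translate x a) (a⁻¹ * w) = y := by
      rw [translate_translate, mul_inv_cancel_left]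
    have heq := (hdom'.translate_eq_self (hya.symm ▸ hdom)).1
    rw [hya] at heq
    rw [hI, heq, hzero]

end CoxeterSystem

theorem proposition4 {B W : Type*} [Finite B] [Group W] {M : CoxeterMatrix B}
    (cs : CoxeterSystem M W) :
    (∀ I ∈ cs.maximalSpherical, IsMaximalFinite (Subgroup.closure I)) ∧
    (∀ H : Subgroup W, IsMaximalFinite H →
      ∃! I : Set W, I ∈ cs.maximalSpherical ∧
        AreConjSubgroups (Subgroup.closure I) H) := by
  classical
  have := Fintype.ofFinite B
  exact ⟨fun _ hI ↦ CoxeterSystem.isMaximalFinite_of_maximalSpherical hI,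
    fun _ hH ↦ CoxeterSystem.existsUnique_maximalSpherical hH⟩
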